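/- **Conventions.** A neural network on $\mathbb R^d$ with $p$ parameters is a finite directed acyclic graph whose nodes carry gates (real functions of the parameter vector $w\in\mathbb R^p$ and of the values on the incoming edges). Layer $0$ consists of the $d$ input coordinates, which are not counted as nodes or as a layer; only root nodes read the input, all other nodes read values of other nodes. The layer of a node is the length of a longest path from layer $0$ to it. Exactly one node has no outgoing edges, and its value is the output. A standard ReLU gate is $v\mapsto \sigma(\langle a,v\rangle+b)$ with $\sigma(z)=\max\{0,z\}$, where each entry of $a$ (one per incoming edge) and $b$ is one of the parameters of the network; one parameter may be used at several places. A function $\phi:\mathbb R^n\to\mathbb R$ is $(t,\alpha,\beta)$-semi-algebraic if there are polynomials $q_1,\dots,q_t$ of degree $\le\alpha$ and finitely many triples $(U_j,L_j,p_j)$ with $U_j,L_j\subseteq\{1,\dots,t\}$ and $p_j$ a polynomial of degree $\le\beta$ such that $$\phi(v)=\sum_j p_j(v)\prod_{i\in L_j}\mathbf 1[q_i(v)<0]\prod_{i\in U_j}\mathbf 1[q_i(v)\ge 0].$$ A decision tree with $n$ nodes is a constant function if $n=1$; if $n>1$ it is a function $x\mapsto f_1(x)$ if $\langle a,x\rangle-b<0$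 and $x\mapsto f_2(x)$ if $\langle a,x\rangle-b\ge0$, where $f_1,f_2$ are decision trees with $l$ and $r$ nodes and $l+r<n$. **Theorem.** Let integers $k\ge1$ and $d\ge1$ be given, and let $h(z)=\sigma(2\sigma(z)-4\sigma(z-1/2))$. The function $f:\mathbb R^d\to\mathbb R$, $f(x)=h^{k^3+4}(x_1)$ ($h$ composed with itself $k^3+4$ times), is computed by a neural network with standard ReLU gates in $2k^3+8$ layers (with all edges between consecutive layers), $3k^3+12$ total nodes, and $4+d$ parameters, each of which is used, and $$\inf_{g\in\mathcal C}\int_{[0,1]^d}|f(x)-g(x)|\,dx\ \ge\ \frac1{64},$$ where $\mathcal C$ is the union of the following two sets of functions: - for all integers $t,\alpha,\beta\ge1$, the functions computed by networks of $(t,\alpha,\beta)$-semi-algebraic gates in $\le k$ layers and with $\le 2^k/(t\alpha\beta)$ nodes; - for all integers $t\ge1$, the linear combinations of $\le t$ decision trees, each with $\le 2^{k^3}/t$ nodes. -/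

import Mathlib

open MeasureTheory

namespace DepthSeparation

noncomputable section

/-- `f : ℝ^ι → ℝ` is `(t, α, β)`-semi-algebraic: there are `t` predicate polynomials `q i` of
(total) degree at most `α` and finitely many triples `(U j, L j, p j)` with `p j` of degree at
most `β`, such that `f` is the sum of the `p j` multiplied by the indicators of `q i < 0`
(for `i ∈ L j`) and of `q i ≥ 0` (for `i ∈ U j`). -/
def IsSemialgebraic {ι : Type} (t α β : ℕ) (f : (ι → ℝ) → ℝ) : Prop :=
  ∃ (q : Fin t → MvPolynomial ι ℝ) (m : ℕ) (U L : Fin m → Finset (Fin t))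
    (p : Fin m → MvPolynomial ι ℝ),
    (∀ i, (q i).totalDegree ≤ α) ∧ (∀ j, (p j).totalDegree ≤ β) ∧
    ∀ v : ι → ℝ, f v = ∑ j, MvPolynomial.eval v (p j)
      * (∏ i ∈ L j, if MvPolynomial.eval v (q i) < 0 then (1 : ℝ) else 0)
      * (∏ i ∈ U j, if 0 ≤ MvPolynomial.eval v (q i) then (1 : ℝ) else 0)

/-- A neural network on `ℝ^d` with `p` parameters. The computing nodes are `Fin numNodes`; layer `0`
consists of the `d` input coordinates `Sum.inl i`, which are not counted as nodes. -/
structure Network (d p : ℕ) where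
  /-- number of nodes above layer `0` -/
  numNodes : ℕ
  /-- the tails of the edges that enter a node -/
  parents : Fin numNodes → Finset (Fin d ⊕ Fin numNodes)
  /-- only root nodes read the input: a node that reads an input coordinate reads nothing else -/
  input_only_at_roots : ∀ v i, Sum.inl i ∈ parents v → ∀ u, Sum.inr u ∉ parents v
  /-- the layer of a node -/
  layer : Fin numNodes → ℕ
  /-- the layer of a node is the length of a longest path that ends there, inputs having layer `0`;
  in particular the graph is acyclic -/
  layer_eq : ∀ v, layer v = (parents v).sup (Sum.elim (fun _ => 0) layer) + 1
  /-- the output node -/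
  out : Fin numNodes
  /-- the output node is the one and only node without outgoing edges -/
  out_iff : ∀ u, u = out ↔ ∀ v, Sum.inr u ∉ parents v
  /-- the gate of a node, a function of the parameters and of the values of the parents -/
  gate : ∀ v, (Fin p → ℝ) → ({s // s ∈ parents v} → ℝ) → ℝ

namespace Network

variable {d p : ℕ}

theorem layer_lt (N : Network d p) {u v : Fin N.numNodes} (h : Sum.inr u ∈ N.parents v) :
    N.layer u < N.layer v := by
  rw [N.layer_eq v]
  exact Nat.lt_succ_of_le
    (Finset.le_sup (f := Sum.elim (fun _ => 0) N.layer) h)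

/-- The value of node `v` for parameters `w` and input `x`. -/
def value (N : Network d p) (w : Fin p → ℝ) (x : Fin d → ℝ) (v : Fin N.numNodes) : ℝ :=
  N.gate v w (fun s => match s with
    | ⟨Sum.inl i, _⟩ => x i
    | ⟨Sum.inr u, _⟩ => value N w x u)
termination_by N.layer v
decreasing_by exact N.layer_lt (by assumption)

/-- The function computed by the network with parameters `w`. -/
def output (N : Network d p) (w : Fin p → ℝ) (x : Fin d → ℝ) : ℝ := N.value w x N.out

/-- The number of layers, layer `0` not included. -/
def numLayers (N : Network d p) : ℕ := Finset.univ.sup N.layer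

/-- Every edge joins two consecutive layers. -/
def IsLayered (N : Network d p) : Prop :=
  ∀ u v, Sum.inr u ∈ N.parents v → N.layer v = N.layer u + 1

/-- Every gate is a standard ReLU gate `z ↦ max 0 (⟨a, z⟩ + b)`, where each weight (one for each
edge) and each bias is one of the `p` parameters of the network. The same parameter may be used at
several places, and each of the `p` parameters is used somewhere. -/
def IsReLU (N : Network d p) : Prop :=
  ∃ (weight : ∀ v, {s // s ∈ N.parents v} → Fin p) (bias : Fin N.numNodes → Fin p),
    (∀ v w z, N.gate v w z = max 0 (∑ s, w (weight v s) * z s + w (bias v))) ∧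
    ∀ j, (∃ v s, weight v s = j) ∨ ∃ v, bias v = j

end Network

/-- Functions on `ℝ^d` computed by networks of `(t, α, β)`-semi-algebraic gates with at most `L`
layers and at most `M` nodes. -/
def semialgebraicNetworks (d t α β L : ℕ) (M : ℝ) : Set ((Fin d → ℝ) → ℝ) :=
  {g | ∃ (p : ℕ) (N : Network d p) (w : Fin p → ℝ),
    (∀ v, IsSemialgebraic t α β (N.gate v w)) ∧
    N.numLayers ≤ L ∧ (N.numNodes : ℝ) ≤ M ∧ g = N.output w}

/-- `IsDecisionTree d n f`: the function `f` on `ℝ^d` is computed by a decision tree with `n`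
nodes. -/
inductive IsDecisionTree (d : ℕ) : ℕ → ((Fin d → ℝ) → ℝ) → Prop
  | leaf (c : ℝ) : IsDecisionTree d 1 (fun _ => c)
  | split (a : Fin d → ℝ) (b : ℝ) {l r n : ℕ} {f₁ f₂ : (Fin d → ℝ) → ℝ}
      (h₁ : IsDecisionTree d l f₁) (h₂ : IsDecisionTree d r f₂) (hn : l + r < n) :
      IsDecisionTree d n (fun x => if 0 ≤ (∑ i, a i * x i) - b then f₂ x else f₁ x)

/-- Linear combinations of at most `t` decision trees on `ℝ^d`, each with at most `M` nodes. -/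
def treeCombinations (d t : ℕ) (M : ℝ) : Set ((Fin d → ℝ) → ℝ) :=
  {g | ∃ (r : ℕ) (c : Fin r → ℝ) (n : Fin r → ℕ) (T : Fin r → (Fin d → ℝ) → ℝ),
    r ≤ t ∧ (∀ i, IsDecisionTree d (n i) (T i) ∧ (n i : ℝ) ≤ M) ∧
    g = fun x => ∑ i, c i * T i x}

/-- The class of shallow competitors: networks of `(t, α, β)`-semi-algebraic gates with at most `k`
layers and at most `2 ^ k / (t α β)` nodes, together with linear combinations of at most `t`
decision trees with at most `2 ^ (k ^ 3) / t` nodes each, for all positive `t`, `α`, `β`. -/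
def shallowClass (d k : ℕ) : Set ((Fin d → ℝ) → ℝ) :=
  {g | ∃ t α β : ℕ, 1 ≤ t ∧ 1 ≤ α ∧ 1 ≤ β ∧
      g ∈ semialgebraicNetworks d t α β k ((2 : ℝ) ^ k / (t * α * β))} ∪
  {g | ∃ t : ℕ, 1 ≤ t ∧ g ∈ treeCombinations d t ((2 : ℝ) ^ (k ^ 3) / t)}

/-- The ReLU triangle map `z ↦ σ(2 σ(z) - 4 σ(z - 1/2))` with `σ(z) = max 0 z`. -/
def triangle (z : ℝ) : ℝ := max 0 (2 * max 0 z - 4 * max 0 (z - 1 / 2))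

end

end DepthSeparation

/-!
A piecewise polynomial function with few pieces of low degree cannot follow a function that
oscillates often. All functions are restricted to lines in the direction of the first coordinate.

*Upper bound.* On `[0, 1]` the iterate `triangle^[m + 1]` consists of `2 ^ m` copies of `triangle`
(`triangle_iterate_apply`), and each further iteration costs three ReLU nodes in two layers
(`triangleNetwork`).

*Competitors.* A semi-algebraic gate fed with polynomials changes its formula only at roots of its
predicates (`IsSemialgebraic.exists_breakpoints`). Hence a new layer cuts every piece into at most
`m t α β ^ i + 1` smaller ones, with `m` the number of nodes, and multiplies the degree by `β`
(`Network.exists_breakpoints`); a decision tree has fewer jumps along a line than nodes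
(`IsDecisionTree.exists_breakpoints`). With the given size bounds, every competitor stays on one
side of the level `1 / 2` between consecutive points of a set of at most `2 ^ (k ^ 3 + 2)`
breakpoints (`shallowClass_spec`).

*Distance.* At least half of the `2 ^ (k ^ 3 + 3)` periods of the oscillating function contain no
breakpoint. On one eighth of each such period the two functions are at least `1 / 4` apart, so they
are `1 / 4` apart on a set of measure at least `1 / 16` of every line
(`volume_far_triangle_iterate`). Fubini's theorem and Markov's inequality give `1 / 64`.
-/

namespace DepthSeparation

/-! ### Properties that hold off finitely many breakpoints -/

/-- `HoldsOff S Q`: the property `Q a b` of intervals `(a, b)` holds for every subinterval of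
`[0, 1]` which contains no point of `S`. Nothing is said about the points of `S` themselves; they
form a null set. The interval may be empty (`b ≤ a`). -/
def HoldsOff (S : Finset ℝ) (Q : ℝ → ℝ → Prop) : Prop :=
  ∀ a b, 0 ≤ a → b ≤ 1 → (∀ s ∈ S, s ∉ Set.Ioo a b) → Q a b

/-- If every interval free of points of `S` becomes good after the insertion of `c` breakpoints,
then `(|S| + 1) (c + 1) - 1` breakpoints suffice: the points of `S` cut `[0, 1]` into `|S| + 1`
intervals. -/
theorem HoldsOff.exists_refinement {S : Finset ℝ} {c : ℕ} {Q : ℝ → ℝ → Prop}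
    (h : HoldsOff S fun a b => ∃ T : Finset ℝ, T.card ≤ c ∧
      ∀ u v, a ≤ u → v ≤ b → (∀ s ∈ T, s ∉ Set.Ioo u v) → Q u v) :
    ∃ T : Finset ℝ, T.card + 1 ≤ (S.card + 1) * (c + 1) ∧ HoldsOff T Q := by
  classical
  -- induction on the number of breakpoints inside an arbitrary base interval `(a, b)`
  have key : ∀ (n : ℕ) (a b : ℝ) (R : Finset ℝ), 0 ≤ a → b ≤ 1 → R ⊆ S →
      (∀ s ∈ S, s ∈ Set.Ioo a b → s ∈ R) → R.card = n →
      ∃ T : Finset ℝ, T.card + 1 ≤ (n + 1) * (c + 1) ∧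
        ∀ u v, a ≤ u → v ≤ b → (∀ s ∈ T, s ∉ Set.Ioo u v) → Q u v := by
    intro n
    induction n using Nat.strong_induction_on with
    | _ n ih =>
      intro a b R ha hb hRS hR hn
      rcases R.eq_empty_or_nonempty with rfl | ⟨s, hs⟩
      · obtain ⟨T, hT, hQ⟩ := h a b ha hb fun s hs hs' => by simpa using hR s hs hs'
        refine ⟨T, ?_, hQ⟩
        simp at hn
        subst hn
        omega
      · by_cases hsab : s ∈ Set.Ioo a b
        · have h1 : (R.filter (· < s)).card + (R.filter (s < ·)).card + 1 ≤ n := by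
            rw [← hn, ← Finset.card_union_of_disjoint, ← Finset.card_insert_of_notMem (a := s)]
            · apply Finset.card_le_card
              intro x hx
              simp only [Finset.mem_insert, Finset.mem_union, Finset.mem_filter] at hx
              rcases hx with rfl | hx | hx
              exacts [hs, hx.1, hx.1]
            · simp
            · rw [Finset.disjoint_filter]
              intro x _ h1 h2
              exact lt_asymm h1 h2
          obtain ⟨T₁, hT₁, hQ₁⟩ := ih _ (by omega) a s (R.filter (· < s)) ha
            (hsab.2.le.trans hb) ((Finset.filter_subset _ _).trans hRS)
            (fun x hx hx' => Finset.mem_filter.2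
              ⟨hR x hx ⟨hx'.1, hx'.2.trans hsab.2⟩, hx'.2⟩) rfl
          obtain ⟨T₂, hT₂, hQ₂⟩ := ih _ (by omega) s b (R.filter (s < ·))
            (ha.trans hsab.1.le) hb ((Finset.filter_subset _ _).trans hRS)
            (fun x hx hx' => Finset.mem_filter.2
              ⟨hR x hx ⟨hsab.1.trans hx'.1, hx'.2⟩, hx'.1⟩) rfl
          refine ⟨insert s (T₁ ∪ T₂), ?_, ?_⟩
          · have h2 := Finset.card_insert_le s (T₁ ∪ T₂)
            have h3 := Finset.card_union_le T₁ T₂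
            have h4 := Nat.mul_le_mul_right (c + 1) (show
              (R.filter (· < s)).card + 1 + ((R.filter (s < ·)).card + 1) ≤ n + 1 by omega)
            rw [add_mul] at h4
            omega
          · intro u v hu hv hT
            rcases le_or_gt s u with hsu | hsu
            · exact hQ₂ u v hsu hv fun x hx => hT x (by simp [hx])
            · have : v ≤ s := not_lt.1 fun hsv => hT s (by simp) ⟨hsu, hsv⟩
              exact hQ₁ u v hu this fun x hx => hT x (by simp [hx])
        · have hc := Finset.card_erase_lt_of_mem hs
          obtain ⟨T, hT, hQ⟩ := ih _ (hn ▸ hc) a b (R.erase s) ha hb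
            ((Finset.erase_subset _ _).trans hRS)
            (fun x hx hx' => Finset.mem_erase.2
              ⟨fun e => hsab (e ▸ hx'), hR x hx hx'⟩) rfl
          exact ⟨T, hT.trans (Nat.mul_le_mul_right _ (by omega)), hQ⟩
  obtain ⟨T, hT, hQ⟩ := key _ 0 1 S le_rfl le_rfl subset_rfl (fun _ hs _ => hs) rfl
  exact ⟨T, hT, hQ⟩

/-- `g` stays on one side of the level `1 / 2` on the interval `(a, b)`. -/
def OneSided (g : ℝ → ℝ) (a b : ℝ) : Prop :=
  (∀ z ∈ Set.Ioo a b, g z < 1 / 2) ∨ ∀ z ∈ Set.Ioo a b, 1 / 2 ≤ g z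

open Polynomial in
theorem eval_neg_or_nonneg_of_roots_notMem {P : ℝ[X]} {a b : ℝ}
    (h : ∀ s ∈ P.roots.toFinset, s ∉ Set.Ioo a b) :
    (∀ z ∈ Set.Ioo a b, P.eval z < 0) ∨ ∀ z ∈ Set.Ioo a b, 0 ≤ P.eval z := by
  by_contra! hc
  obtain ⟨⟨z₁, hz₁, h₁⟩, z₂, hz₂, h₂⟩ := hc
  obtain ⟨z, hz, hz0⟩ := isPreconnected_Ioo.intermediate_value hz₂ hz₁
    P.continuous.continuousOn (show (0 : ℝ) ∈ Set.Icc _ _ from ⟨h₂.le, h₁⟩)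
  have hP : P ≠ 0 := by
    rintro rfl
    simp at h₂
  exact h z (by simpa [hP] using hz0) hz

open Polynomial in
theorem card_roots_toFinset_le {P : ℝ[X]} {n : ℕ} (h : P.natDegree ≤ n) :
    P.roots.toFinset.card ≤ n :=
  (Multiset.toFinset_card_le _).trans (P.card_roots'.trans h)

/-! ### Semi-algebraic networks along a line -/

open Polynomial in
/-- A semi-algebraic gate fed with univariate polynomials of degree at most `D` is piecewise a
polynomial of degree at most `β D`; the breakpoints are the roots of the `t` composed predicates,
each of degree at most `α D`. -/
theorem IsSemialgebraic.exists_breakpoints {ι : Type} {t α β D : ℕ} {φ : (ι → ℝ) → ℝ}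
    (hφ : IsSemialgebraic t α β φ) {P : ι → ℝ[X]} (hP : ∀ i, (P i).natDegree ≤ D) :
    ∃ T : Finset ℝ, T.card ≤ t * (α * D) ∧ ∀ u v, (∀ s ∈ T, s ∉ Set.Ioo u v) →
      ∃ R : ℝ[X], R.natDegree ≤ β * D ∧
        ∀ z ∈ Set.Ioo u v, φ (fun i => (P i).eval z) = R.eval z := by
  classical
  obtain ⟨q, m, U, L, p, hq, hp, hφ⟩ := hφ
  have hev : ∀ (z : ℝ) (r : MvPolynomial ι ℝ),
      MvPolynomial.eval (fun i => (P i).eval z) r = (MvPolynomial.aeval P r).eval z := by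
    intro z r
    induction r using MvPolynomial.induction_on <;> simp_all
  refine ⟨Finset.univ.biUnion fun i => (MvPolynomial.aeval P (q i)).roots.toFinset, ?_, ?_⟩
  · refine (Finset.card_biUnion_le_card_mul _ _ (α * D) fun i _ =>
      card_roots_toFinset_le (MvPolynomial.aeval_natDegree_le _ (hq i) _ hP)).trans ?_
    simp
  · intro u v huv
    have hsign : ∀ i, ∃ e : Prop, ∀ z ∈ Set.Ioo u v,
        ((MvPolynomial.aeval P (q i)).eval z < 0 ↔ e) := fun i => by
      rcases eval_neg_or_nonneg_of_roots_notMem (P := MvPolynomial.aeval P (q i)) (a := u) (b := v)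
        (fun s hs => huv s (Finset.mem_biUnion.2 ⟨i, Finset.mem_univ _, hs⟩)) with h | h
      · exact ⟨True, fun z hz => by simpa using h z hz⟩
      · exact ⟨False, fun z hz => by simpa using h z hz⟩
    choose e he using hsign
    refine ⟨∑ j, MvPolynomial.aeval P (p j) * C ((∏ i ∈ L j, if e i then (1 : ℝ) else 0) *
      ∏ i ∈ U j, if e i then (0 : ℝ) else 1), ?_, ?_⟩
    · refine natDegree_sum_le_of_forall_le _ _ fun j _ => ?_
      exact (natDegree_mul_C_le _ _).trans (MvPolynomial.aeval_natDegree_le _ (hp j) _ hP)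
    · intro z hz
      rw [hφ, eval_finsetSum]
      refine Finset.sum_congr rfl fun j _ => ?_
      rw [eval_mul, eval_C, mul_assoc, hev]
      congr 2
      · refine Finset.prod_congr rfl fun i _ => ?_
        simp only [hev, he i z hz]
      · refine Finset.prod_congr rfl fun i _ => ?_
        simp only [hev, ← not_lt, he i z hz, ite_not]

theorem Network.value_eq {d p : ℕ} (N : Network d p) (w : Fin p → ℝ) (x : Fin d → ℝ)
    (v : Fin N.numNodes) :
    N.value w x v = N.gate v w fun s => Sum.elim x (N.value w x) s.1 := by
  rw [Network.value]
  congr 1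
  funext ⟨s, hs⟩
  cases s <;> rfl

open Polynomial in
/-- Passing from one layer to the next multiplies the number of pieces by at most
`m t α β ^ i + 1`, where `m` is the number of nodes, and the degree on each piece by `β`. -/
theorem Network.exists_breakpoints {d p t α β : ℕ} (N : Network d p) (w : Fin p → ℝ)
    (hN : ∀ v, IsSemialgebraic t α β (N.gate v w)) (hβ : 1 ≤ β) {l : ℝ → Fin d → ℝ}
    (hl : ∀ j, ∃ P : ℝ[X], P.natDegree ≤ 1 ∧ ∀ z, l z j = P.eval z) (i : ℕ) :
    ∃ S : Finset ℝ, S.card + 1 ≤ ∏ j ∈ Finset.range i, (N.numNodes * t * α * β ^ j + 1) ∧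
      HoldsOff S fun a b => ∀ v, N.layer v ≤ i → ∃ P : ℝ[X], P.natDegree ≤ β ^ i ∧
        ∀ z ∈ Set.Ioo a b, N.value w (l z) v = P.eval z := by
  classical
  induction i with
  | zero =>
    refine ⟨∅, by simp, fun a b _ _ _ v hv => ?_⟩
    rw [N.layer_eq v] at hv
    omega
  | succ i ih =>
    obtain ⟨S, hS, hQ⟩ := ih
    rw [Finset.prod_range_succ]
    suffices h : HoldsOff S fun a b => ∃ T : Finset ℝ, T.card ≤ N.numNodes * t * α * β ^ i ∧
        ∀ u v, a ≤ u → v ≤ b → (∀ s ∈ T, s ∉ Set.Ioo u v) →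
        ∀ n, N.layer n ≤ i + 1 → ∃ P : ℝ[X], P.natDegree ≤ β ^ (i + 1) ∧
          ∀ z ∈ Set.Ioo u v, N.value w (l z) n = P.eval z by
      obtain ⟨T, hT, hT'⟩ := h.exists_refinement
      exact ⟨T, hT.trans (Nat.mul_le_mul_right _ hS), hT'⟩
    intro a b ha hb hab
    have hQ := hQ a b ha hb hab
    have hin : ∀ n, ∃ T : Finset ℝ, T.card ≤ t * (α * β ^ i) ∧
        ∀ u v, a ≤ u → v ≤ b → (∀ s ∈ T, s ∉ Set.Ioo u v) → N.layer n ≤ i + 1 →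
        ∃ P : ℝ[X], P.natDegree ≤ β ^ (i + 1) ∧
          ∀ z ∈ Set.Ioo u v, N.value w (l z) n = P.eval z := by
      intro n
      by_cases hn : N.layer n ≤ i + 1
      · have hpar : ∀ s : {s // s ∈ N.parents n}, ∃ P : ℝ[X], P.natDegree ≤ β ^ i ∧
            ∀ z ∈ Set.Ioo a b, Sum.elim (l z) (N.value w (l z)) s.1 = P.eval z := by
          rintro ⟨s | s, hs⟩
          · obtain ⟨P, hP, hP'⟩ := hl s
            exact ⟨P, hP.trans (Nat.one_le_pow _ _ hβ), fun z _ => hP' z⟩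
          · have := N.layer_lt hs
            exact hQ s (by omega)
        choose P hP hP' using hpar
        obtain ⟨T, hT, hR⟩ := (hN n).exists_breakpoints hP
        refine ⟨T, hT, fun u v hu hv huv _ => ?_⟩
        obtain ⟨R, hR, hR'⟩ := hR u v huv
        refine ⟨R, by rwa [pow_succ'], fun z hz => ?_⟩
        rw [N.value_eq, ← hR' z hz]
        congr 1
        funext s
        exact hP' s z ⟨hu.trans_lt hz.1, hz.2.trans_le hv⟩
      · exact ⟨∅, by simp, fun u v _ _ _ h => absurd h hn⟩
    choose T hT hT' using hin
    refine ⟨Finset.univ.biUnion T, ?_, fun u v hu hv huv n hn => ?_⟩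
    · refine (Finset.card_biUnion_le_card_mul _ _ _ fun n _ => hT n).trans ?_
      simp [mul_assoc]
    · exact hT' n u v hu hv
        (fun s hs => huv s (Finset.mem_biUnion.2 ⟨n, Finset.mem_univ _, hs⟩)) hn

/-- The bound for the number of pieces of a network with `m t α = A`, after the pieces have been
cut at the roots of a polynomial of degree `β ^ k`. -/
theorem prod_pieces_le {k A β : ℕ} (hk : 1 ≤ k) (hβ : 1 ≤ β) (hA : 1 ≤ A)
    (h : A * β ≤ 2 ^ k) :
    (∏ j ∈ Finset.range k, (A * β ^ j + 1)) * (β ^ k + 1) ≤ 2 ^ (k ^ 3 + 2) := by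
  obtain ⟨n, rfl⟩ : ∃ n, k = n + 1 := ⟨k - 1, by omega⟩
  set B := 2 ^ (n + 1) with hB
  have hβB : β ≤ B := (Nat.le_mul_of_pos_left _ hA).trans h
  have hAB : A ≤ B := (Nat.le_mul_of_pos_right _ hβ).trans h
  have hB1 : 1 ≤ B := Nat.one_le_two_pow
  have h1 : (A + 1) * (β ^ (n + 1) + 1) ≤ 4 * B ^ (n + 1) := by
    have e1 : A * β ^ (n + 1) ≤ B ^ (n + 1) := by
      calc A * β ^ (n + 1) = A * β * β ^ n := by ring
        _ ≤ B * B ^ n := Nat.mul_le_mul h (Nat.pow_le_pow_left hβB n)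
        _ = B ^ (n + 1) := by ring
    have e2 : β ^ (n + 1) ≤ B ^ (n + 1) := Nat.pow_le_pow_left hβB _
    have e3 : A ≤ B ^ (n + 1) := hAB.trans (Nat.le_self_pow (by omega) _)
    have e4 : 1 ≤ B ^ (n + 1) := Nat.one_le_pow _ _ hB1
    calc (A + 1) * (β ^ (n + 1) + 1) = A * β ^ (n + 1) + β ^ (n + 1) + A + 1 := by ring
      _ ≤ 4 * B ^ (n + 1) := by omega
  have h2 : ∀ i, ∏ j ∈ Finset.range i, (A * β ^ (j + 1) + 1)
      ≤ 2 ^ (∑ j ∈ Finset.range i, ((n + 1) * (j + 1) + 1)) := by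
    intro i
    rw [← Finset.prod_pow_eq_pow_sum]
    refine Finset.prod_le_prod' fun j _ => ?_
    have e1 : A * β ^ (j + 1) ≤ B ^ (j + 1) := by
      calc A * β ^ (j + 1) = A * β * β ^ j := by ring
        _ ≤ B * B ^ j := Nat.mul_le_mul h (Nat.pow_le_pow_left hβB j)
        _ = B ^ (j + 1) := by ring
    have e4 : 1 ≤ B ^ (j + 1) := Nat.one_le_pow _ _ hB1
    rw [pow_succ 2, pow_mul 2, ← hB]
    omega
  have h3 : ∀ i, 2 * ∑ j ∈ Finset.range i, ((n + 1) * (j + 1) + 1)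
      = (n + 1) * (i * (i + 1)) + 2 * i := by
    intro i
    induction i with
    | zero => simp
    | succ i ih => rw [Finset.sum_range_succ, mul_add, ih]; ring
  rw [Finset.prod_range_succ', pow_zero, mul_one, mul_assoc]
  refine (Nat.mul_le_mul (h2 n) h1).trans ?_
  rw [hB, ← pow_mul, show 4 = 2 ^ 2 by norm_num, ← pow_add, ← pow_add]
  refine Nat.pow_le_pow_right (by norm_num) ?_
  have h4 := h3 n
  have h5 : (n + 1) * (n * (n + 1)) + 2 * n + 2 * ((n + 1) * (n + 1)) ≤ 2 * (n + 1) ^ 3 := by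
    rcases n with _ | n
    · norm_num
    · nlinarith [sq_nonneg n]
  omega

open Polynomial in
theorem semialgebraicNetworks_exists_breakpoints {d k t α β : ℕ} (hk : 1 ≤ k) (ht : 1 ≤ t)
    (hα : 1 ≤ α) (hβ : 1 ≤ β) {g : (Fin d → ℝ) → ℝ}
    (hg : g ∈ semialgebraicNetworks d t α β k ((2 : ℝ) ^ k / (t * α * β))) {l : ℝ → Fin d → ℝ}
    (hl : ∀ j, ∃ P : ℝ[X], P.natDegree ≤ 1 ∧ ∀ z, l z j = P.eval z) :
    ∃ S : Finset ℝ, S.card ≤ 2 ^ (k ^ 3 + 2) ∧ HoldsOff S (OneSided fun z => g (l z)) := by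
  obtain ⟨p, N, w, hN, hL, hM, rfl⟩ := hg
  obtain ⟨S, hS, hQ⟩ := N.exists_breakpoints w hN hβ hl k
  have hm : 1 ≤ N.numNodes := N.out.pos
  have hA : N.numNodes * t * α * β ≤ 2 ^ k := by
    rw [le_div_iff₀ (by positivity)] at hM
    rw [← mul_assoc, ← mul_assoc] at hM
    exact_mod_cast hM
  have hc := prod_pieces_le hk hβ (Nat.mul_pos (Nat.mul_pos hm ht) hα) hA
  suffices h : HoldsOff S fun a b => ∃ T : Finset ℝ, T.card ≤ β ^ k ∧
      ∀ u v, a ≤ u → v ≤ b → (∀ s ∈ T, s ∉ Set.Ioo u v) →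
        OneSided (fun z => N.output w (l z)) u v by
    obtain ⟨T, hT, hT'⟩ := h.exists_refinement
    have := (hT.trans (Nat.mul_le_mul_right _ hS)).trans hc
    exact ⟨T, by omega, hT'⟩
  intro a b ha hb hab
  obtain ⟨P, hP, hP'⟩ := hQ a b ha hb hab N.out
    ((Finset.le_sup (f := N.layer) (Finset.mem_univ _)).trans hL)
  refine ⟨(P - C (1 / 2)).roots.toFinset, card_roots_toFinset_le ?_, fun u v hu hv huv => ?_⟩
  · rwa [natDegree_sub_C]
  · refine (eval_neg_or_nonneg_of_roots_notMem huv).imp ?_ ?_ <;>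
    · intro h z hz
      have h1 := h z hz
      have h2 := hP' z ⟨hu.trans_lt hz.1, hz.2.trans_le hv⟩
      simp only [eval_sub, eval_C] at h1
      simp only [Network.output]
      linarith

/-! ### Decision trees along a line -/

open Polynomial in
theorem IsDecisionTree.exists_breakpoints {d n : ℕ} {f : (Fin d → ℝ) → ℝ}
    (hf : IsDecisionTree d n f) {l : ℝ → Fin d → ℝ}
    (hl : ∀ j, ∃ P : ℝ[X], P.natDegree ≤ 1 ∧ ∀ z, l z j = P.eval z) :
    ∃ S : Finset ℝ, S.card + 1 ≤ n ∧ ∀ a b, (∀ s ∈ S, s ∉ Set.Ioo a b) →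
      ∃ c, ∀ z ∈ Set.Ioo a b, f (l z) = c := by
  classical
  induction hf with
  | leaf c => exact ⟨∅, by simp, fun a b _ => ⟨c, fun _ _ => rfl⟩⟩
  | @split a b m r n f₁ f₂ _ _ hn ih₁ ih₂ =>
    obtain ⟨S₁, hS₁, h₁⟩ := ih₁
    obtain ⟨S₂, hS₂, h₂⟩ := ih₂
    choose P hP hP' using hl
    set R : ℝ[X] := ∑ i, C (a i) * P i - C b with hR
    have hRd : R.natDegree ≤ 1 := by
      rw [hR, natDegree_sub_C]
      exact natDegree_sum_le_of_forall_le _ _ fun i _ => (natDegree_C_mul_le _ _).trans (hP i)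
    have hRe : ∀ z, (∑ i, a i * l z i) - b = R.eval z := fun z => by
      simp [hR, hP', eval_finsetSum]
    refine ⟨R.roots.toFinset ∪ (S₁ ∪ S₂), ?_, fun u v huv => ?_⟩
    · have e1 := Finset.card_union_le R.roots.toFinset (S₁ ∪ S₂)
      have e2 := Finset.card_union_le S₁ S₂
      have e3 := card_roots_toFinset_le hRd
      omega
    · simp only [hRe]
      rcases eval_neg_or_nonneg_of_roots_notMem (P := R) (a := u) (b := v)
        (fun s hs => huv s (Finset.mem_union_left _ hs)) with h | h
      · obtain ⟨c, hc⟩ := h₁ u v fun s hs => huv s (by simp [hs])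
        exact ⟨c, fun z hz => by rw [if_neg (not_le.2 (h z hz)), hc z hz]⟩
      · obtain ⟨c, hc⟩ := h₂ u v fun s hs => huv s (by simp [hs])
        exact ⟨c, fun z hz => by rw [if_pos (h z hz), hc z hz]⟩

open Polynomial in
theorem treeCombinations_exists_breakpoints {d t B : ℕ} (ht : 1 ≤ t) {g : (Fin d → ℝ) → ℝ}
    (hg : g ∈ treeCombinations d t ((B : ℝ) / t)) {l : ℝ → Fin d → ℝ}
    (hl : ∀ j, ∃ P : ℝ[X], P.natDegree ≤ 1 ∧ ∀ z, l z j = P.eval z) :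
    ∃ S : Finset ℝ, S.card ≤ B ∧ HoldsOff S (OneSided fun z => g (l z)) := by
  classical
  obtain ⟨r, c, n, T, hr, hT, rfl⟩ := hg
  choose S hS h using fun i => (hT i).1.exists_breakpoints hl
  refine ⟨Finset.univ.biUnion S, ?_, fun a b _ _ hab => ?_⟩
  · have h1 : ((Finset.univ.biUnion S).card : ℝ) ≤ r * ((B : ℝ) / t) := by
      calc ((Finset.univ.biUnion S).card : ℝ) ≤ ((∑ i, (S i).card : ℕ) : ℝ) :=
            Nat.cast_le.2 Finset.card_biUnion_le
        _ = ∑ i, ((S i).card : ℝ) := by push_cast; rfl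
        _ ≤ ∑ _i : Fin r, (B : ℝ) / t := Finset.sum_le_sum fun i _ =>
            (Nat.cast_le.2 (by have := hS i; omega)).trans (hT i).2
        _ = r * ((B : ℝ) / t) := by simp
    have h2 : (r : ℝ) * ((B : ℝ) / t) ≤ B := by
      calc (r : ℝ) * ((B : ℝ) / t) ≤ t * ((B : ℝ) / t) := by gcongr
        _ = B := mul_div_cancel₀ _ (by positivity)
    exact_mod_cast h1.trans h2
  · choose e he using fun i => h i a b fun s hs =>
      hab s (Finset.mem_biUnion.2 ⟨i, Finset.mem_univ _, hs⟩)
    have hconst : ∀ z ∈ Set.Ioo a b, ∑ i, c i * T i (l z) = ∑ i, c i * e i := fun z hz =>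
      Finset.sum_congr rfl fun i _ => by rw [he i z hz]
    rcases lt_or_ge (∑ i, c i * e i) (1 / 2) with h' | h'
    · exact Or.inl fun z hz => by simpa only [hconst z hz] using h'
    · exact Or.inr fun z hz => by simpa only [hconst z hz] using h'

/-! ### Measurability and boundedness of the competitors -/

theorem IsSemialgebraic.measurable {ι : Type} [Finite ι] {t α β : ℕ} {φ : (ι → ℝ) → ℝ}
    (hφ : IsSemialgebraic t α β φ) : Measurable φ := by
  obtain ⟨q, m, U, L, p, -, -, hφ⟩ := hφ
  have hm : ∀ r : MvPolynomial ι ℝ, Measurable fun v : ι → ℝ => MvPolynomial.eval v r :=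
    fun r => r.continuous_eval.measurable
  rw [funext hφ]
  refine Finset.measurable_sum _ fun j _ => ((hm _).mul ?_).mul ?_
  · exact Finset.measurable_prod _ fun i _ => Measurable.ite
      (measurableSet_lt (hm _) measurable_const) measurable_const measurable_const
  · exact Finset.measurable_prod _ fun i _ => Measurable.ite
      (measurableSet_le measurable_const (hm _)) measurable_const measurable_const

theorem IsSemialgebraic.exists_bound {ι : Type} {t α β : ℕ} {φ : (ι → ℝ) → ℝ}
    (hφ : IsSemialgebraic t α β φ) (C : ι → ℝ) :
    ∃ C', ∀ v : ι → ℝ, (∀ i, |v i| ≤ C i) → |φ v| ≤ C' := by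
  obtain ⟨q, m, U, L, p, -, -, hφ⟩ := hφ
  have hb : ∀ j, ∃ B, ∀ v : ι → ℝ, (∀ i, |v i| ≤ C i) → |MvPolynomial.eval v (p j)| ≤ B := by
    intro j
    have hK : IsCompact (Set.pi Set.univ fun i => Set.Icc (-C i) (C i)) :=
      isCompact_univ_pi fun i => isCompact_Icc
    obtain ⟨B, hB⟩ := hK.exists_bound_of_continuousOn
      (f := fun v => MvPolynomial.eval v (p j)) (p j).continuous_eval.continuousOn
    exact ⟨B, fun v hv => hB v fun i _ => abs_le.1 (hv i)⟩
  choose B hB using hb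
  have h01 : ∀ {n : ℕ} (s : Finset (Fin n)) (P : Fin n → Prop) [DecidablePred P],
      |∏ i ∈ s, if P i then (1 : ℝ) else 0| ≤ 1 := by
    intro n s P _
    rw [Finset.abs_prod]
    refine Finset.prod_le_one (fun _ _ => abs_nonneg _) fun i _ => ?_
    split_ifs <;> simp
  refine ⟨∑ j, B j, fun v hv => ?_⟩
  rw [hφ]
  refine (Finset.abs_sum_le_sum_abs _ _).trans (Finset.sum_le_sum fun j _ => ?_)
  rw [abs_mul, abs_mul]
  have h0 : 0 ≤ B j := (abs_nonneg _).trans (hB j v hv)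
  calc _ ≤ B j * 1 * 1 := mul_le_mul (mul_le_mul (hB j v hv) (h01 _ _) (abs_nonneg _) h0)
        (h01 _ _) (abs_nonneg _) (by simpa using h0)
    _ = B j := by ring

theorem Network.measurable_output {d p t α β : ℕ} (N : Network d p) (w : Fin p → ℝ)
    (hN : ∀ v, IsSemialgebraic t α β (N.gate v w)) : Measurable (N.output w) := by
  have key : ∀ (i : ℕ) (v), N.layer v = i → Measurable fun x => N.value w x v := by
    intro i
    induction i using Nat.strong_induction_on with
    | _ i ih =>
      intro v hv
      simp only [N.value_eq w _ v]
      refine (hN v).measurable.comp (measurable_pi_iff.2 ?_)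
      rintro ⟨s | s, hs⟩
      · exact measurable_pi_apply s
      · exact ih _ (hv ▸ N.layer_lt hs) s rfl
  exact key _ _ rfl

theorem Network.exists_bound_output {d p t α β : ℕ} (N : Network d p) (w : Fin p → ℝ)
    (hN : ∀ v, IsSemialgebraic t α β (N.gate v w)) :
    ∃ C, ∀ x ∈ Set.Icc (0 : Fin d → ℝ) 1, |N.output w x| ≤ C := by
  have key : ∀ (i : ℕ) (v), N.layer v = i →
      ∃ C, ∀ x ∈ Set.Icc (0 : Fin d → ℝ) 1, |N.value w x v| ≤ C := by
    intro i
    induction i using Nat.strong_induction_on with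
    | _ i ih =>
      intro v hv
      have hpar : ∀ s : {s // s ∈ N.parents v}, ∃ C, ∀ x ∈ Set.Icc (0 : Fin d → ℝ) 1,
          |Sum.elim x (N.value w x) s.1| ≤ C := by
        rintro ⟨s | s, hs⟩
        · exact ⟨1, fun x hx => abs_le.2
            ⟨(show (-1 : ℝ) ≤ 0 by norm_num).trans (hx.1 s), hx.2 s⟩⟩
        · exact ih _ (hv ▸ N.layer_lt hs) s rfl
      choose C hC using hpar
      obtain ⟨C', hC'⟩ := (hN v).exists_bound C
      exact ⟨C', fun x hx => by rw [N.value_eq]; exact hC' _ fun s => hC s x hx⟩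
  exact key _ _ rfl

theorem IsDecisionTree.measurable {d n : ℕ} {f : (Fin d → ℝ) → ℝ}
    (hf : IsDecisionTree d n f) : Measurable f := by
  induction hf with
  | leaf c => exact measurable_const
  | split a b _ _ _ ih₁ ih₂ =>
    refine Measurable.ite (measurableSet_le measurable_const ?_) ih₂ ih₁
    fun_prop

theorem IsDecisionTree.exists_bound {d n : ℕ} {f : (Fin d → ℝ) → ℝ}
    (hf : IsDecisionTree d n f) : ∃ C, ∀ x, |f x| ≤ C := by
  induction hf with
  | leaf c => exact ⟨|c|, fun _ => le_rfl⟩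
  | split a b _ _ _ ih₁ ih₂ =>
    obtain ⟨C₁, h₁⟩ := ih₁
    obtain ⟨C₂, h₂⟩ := ih₂
    refine ⟨max C₁ C₂, fun x => ?_⟩
    dsimp only
    split_ifs
    exacts [(h₂ x).trans (le_max_right _ _), (h₁ x).trans (le_max_left _ _)]

open Polynomial in
/-- All that the lower bound uses about the competitors. -/
theorem shallowClass_spec {d k : ℕ} (hk : 1 ≤ k) {g : (Fin d → ℝ) → ℝ}
    (hg : g ∈ shallowClass d k) :
    Measurable g ∧ (∃ C, ∀ x ∈ Set.Icc (0 : Fin d → ℝ) 1, |g x| ≤ C) ∧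
      ∀ l : ℝ → Fin d → ℝ, (∀ j, ∃ P : ℝ[X], P.natDegree ≤ 1 ∧ ∀ z, l z j = P.eval z) →
        ∃ S : Finset ℝ, S.card ≤ 2 ^ (k ^ 3 + 2) ∧ HoldsOff S (OneSided fun z => g (l z)) := by
  rcases hg with ⟨t, α, β, ht, hα, hβ, hg⟩ | ⟨t, ht, hg⟩
  · refine ⟨?_, ?_, fun l hl => semialgebraicNetworks_exists_breakpoints hk ht hα hβ hg hl⟩ <;>
    obtain ⟨p, N, w, hN, -, -, rfl⟩ := hg
    exacts [N.measurable_output w hN, N.exists_bound_output w hN]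
  · refine ⟨?_, ?_, fun l hl => ?_⟩
    · obtain ⟨r, c, n, T, -, hT, rfl⟩ := hg
      exact Finset.measurable_sum _ fun i _ => (hT i).1.measurable.const_mul _
    · obtain ⟨r, c, n, T, -, hT, rfl⟩ := hg
      choose C hC using fun i => (hT i).1.exists_bound
      refine ⟨∑ i, |c i| * C i, fun x _ => ?_⟩
      refine (Finset.abs_sum_le_sum_abs _ _).trans (Finset.sum_le_sum fun i _ => ?_)
      rw [abs_mul]
      exact mul_le_mul_of_nonneg_left (hC i x) (abs_nonneg _)
    · obtain ⟨S, hS, h⟩ := treeCombinations_exists_breakpoints (B := 2 ^ k ^ 3) ht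
        (by exact_mod_cast hg) hl
      exact ⟨S, hS.trans (Nat.pow_le_pow_right (by norm_num) (by omega)), h⟩

/-! ### Iterates of the triangle map -/

theorem triangle_of_le {z : ℝ} (h0 : 0 ≤ z) (h1 : z ≤ 1 / 2) : triangle z = 2 * z := by
  rw [triangle, max_eq_right h0, max_eq_left (sub_nonpos.2 h1), mul_zero, sub_zero,
    max_eq_right (by linarith)]

theorem triangle_of_ge {z : ℝ} (h0 : 1 / 2 ≤ z) (h1 : z ≤ 1) : triangle z = 2 * (1 - z) := by
  rw [triangle, max_eq_right (show 0 ≤ z by linarith), max_eq_right (sub_nonneg.2 h0),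
    max_eq_right (by linarith)]
  ring

theorem continuous_triangle : Continuous triangle := by
  unfold triangle
  fun_prop

/-- The iterate `triangle^[m + 1]` consists of `2 ^ m` scaled copies of `triangle` on `[0, 1]`. -/
theorem triangle_iterate_apply (m : ℕ) : ∀ (j : ℕ) (y : ℝ), j < 2 ^ m → 0 ≤ y → y ≤ 1 →
    triangle^[m + 1] ((j + y) / 2 ^ m) = triangle y := by
  induction m with
  | zero =>
    intro j y hj _ _
    have : j = 0 := by simpa using hj
    simp [this]
  | succ m ih =>
    intro j y hj h0 h1
    have hM : (0 : ℝ) < 2 ^ m := by positivity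
    rw [Function.iterate_succ_apply]
    rcases lt_or_ge j (2 ^ m) with h | h
    · have hj' : (j : ℝ) + 1 ≤ 2 ^ m := by exact_mod_cast h
      rw [← ih j y h h0 h1, triangle_of_le]
      · congr 1
        rw [pow_succ]
        field_simp
      · positivity
      · rw [pow_succ, div_le_div_iff₀ (by positivity) (by norm_num)]
        nlinarith
    · -- the right half is mirrored: period `j` is mapped to period `2 ^ (m + 1) - 1 - j`
      obtain ⟨i, hi⟩ : ∃ i, j + i + 1 = 2 ^ (m + 1) :=
        ⟨2 ^ (m + 1) - 1 - j, by omega⟩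
      have hj' : (2 : ℝ) ^ m ≤ j := by exact_mod_cast h
      have hi' : (j : ℝ) + i + 1 = 2 ^ m * 2 := by rw [← pow_succ]; exact_mod_cast hi
      have hsymm : triangle y = triangle (1 - y) := by
        rcases le_total y (1 / 2) with hy | hy
        · rw [triangle_of_le h0 hy, triangle_of_ge (by linarith) (by linarith)]
          ring
        · rw [triangle_of_ge hy h1, triangle_of_le (by linarith) (by linarith)]
      rw [hsymm, ← ih i (1 - y) (by rw [pow_succ] at hi; omega) (by linarith) (by linarith),
        triangle_of_ge]
      · congr 1
        rw [pow_succ]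
        field_simp
        linarith
      · rw [pow_succ, div_le_div_iff₀ (by norm_num) (by positivity)]
        nlinarith
      · rw [pow_succ, div_le_one (by positivity)]
        have : (0 : ℝ) ≤ i := Nat.cast_nonneg _
        linarith

/-! ### The lower bound -/

/-- A function that is one-sided off `2 ^ m` points has distance at least `1 / 4` from
`triangle^[m + 2]` on a set of measure at least `1 / 16`: at least half of the `2 ^ (m + 1)`
periods are free of breakpoints. On a free period the value `1 / 2` separates the competitor
from `triangle` either on the first eighth (where `triangle ≤ 1 / 4`) or on the fourth eighth
(where `triangle ≥ 3 / 4`). -/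
theorem volume_far_triangle_iterate {G : ℝ → ℝ} {m : ℕ} {S : Finset ℝ}
    (hS : S.card ≤ 2 ^ m) (hG : HoldsOff S (OneSided G)) :
    ENNReal.ofReal (1 / 16) ≤
      volume {z | z ∈ Set.Icc (0 : ℝ) 1 ∧ 1 / 4 ≤ |triangle^[m + 2] z - G z|} := by
  classical
  set E := {z | z ∈ Set.Icc (0 : ℝ) 1 ∧ 1 / 4 ≤ |triangle^[m + 2] z - G z|}
  set M : ℝ := 2 ^ (m + 1) with hM
  have hM0 : 0 < M := by positivity
  set J := (Finset.range (2 ^ (m + 1))).filter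
    fun j : ℕ => ∀ s ∈ S, s ∉ Set.Ioo ((j : ℝ) / M) ((j + 1) / M) with hJ
  have hcard : 2 ^ m ≤ J.card := by
    have h1 : (Finset.range (2 ^ (m + 1))).filter
        (fun j : ℕ => ¬ ∀ s ∈ S, s ∉ Set.Ioo ((j : ℝ) / M) ((j + 1) / M))
          ⊆ S.image fun s => ⌊s * M⌋₊ := by
      intro j hj
      simp only [Finset.mem_filter, not_forall, not_not] at hj
      obtain ⟨-, s, hs, h⟩ := hj
      refine Finset.mem_image.2 ⟨s, hs, ?_⟩
      rw [Set.mem_Ioo, div_lt_iff₀ hM0, lt_div_iff₀ hM0] at h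
      rw [Nat.floor_eq_iff ((Nat.cast_nonneg j).trans h.1.le)]
      exact ⟨h.1.le, h.2⟩
    have h2 := (Finset.card_le_card h1).trans Finset.card_image_le
    have h3 := Finset.card_filter_add_card_filter_not (s := Finset.range (2 ^ (m + 1)))
      (fun j : ℕ => ∀ s ∈ S, s ∉ Set.Ioo ((j : ℝ) / M) ((j + 1) / M))
    rw [← hJ, Finset.card_range, pow_succ] at h3
    rw [pow_succ] at h2
    omega
  have hper : ∀ j ∈ J, ∃ c : ℝ, 0 ≤ c ∧ c ≤ 7 / 8 ∧
      Set.Ioo ((j + c) / M) ((j + c + 1 / 8) / M) ⊆ E := by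
    intro j hj
    obtain ⟨hjM, hfree⟩ := Finset.mem_filter.1 hj
    have hjM : j < 2 ^ (m + 1) := Finset.mem_range.1 hjM
    have hjM' : (j : ℝ) + 1 ≤ M := by rw [hM]; exact_mod_cast hjM
    have hz : ∀ {c : ℝ} {z : ℝ}, 0 ≤ c → c ≤ 7 / 8 →
        z ∈ Set.Ioo ((j + c) / M) ((j + c + 1 / 8) / M) →
        z ∈ Set.Icc (0 : ℝ) 1 ∧ z ∈ Set.Ioo ((j : ℝ) / M) ((j + 1) / M) ∧
          c < z * M - j ∧ z * M - j < c + 1 / 8 ∧ triangle^[m + 2] z = triangle (z * M - j) := by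
      intro c z hc hc' hz
      rw [Set.mem_Ioo, div_lt_iff₀ hM0, lt_div_iff₀ hM0] at hz
      have hj0 : (0 : ℝ) ≤ j := Nat.cast_nonneg j
      refine ⟨⟨?_, ?_⟩, ⟨?_, ?_⟩, by linarith, by linarith, ?_⟩
      · nlinarith
      · nlinarith
      · by_contra hcon
        rw [not_lt, le_div_iff₀ hM0] at hcon
        have := hz.1
        rcases hc.eq_or_lt with rfl | hc0 <;> linarith
      · rw [lt_div_iff₀ hM0]
        linarith
      · rw [← triangle_iterate_apply (m + 1) j (z * M - j) hjM (by linarith) (by linarith)]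
        congr 1
        rw [← hM]
        field_simp
        ring
    rcases hG ((j : ℝ) / M) ((j + 1) / M) (by positivity) ((div_le_one hM0).2 hjM') hfree
      with h | h
    · refine ⟨3 / 8, by norm_num, by norm_num, fun z hzm => ?_⟩
      obtain ⟨h1, h2, h3, h4, h5⟩ := hz (by norm_num) (by norm_num) hzm
      refine ⟨h1, ?_⟩
      rw [h5, triangle_of_le (by linarith) (by linarith)]
      refine le_trans ?_ (le_abs_self _)
      linarith [h z h2]
    · refine ⟨0, le_rfl, by norm_num, fun z hzm => ?_⟩
      obtain ⟨h1, h2, h3, h4, h5⟩ := hz le_rfl (by norm_num) hzm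
      refine ⟨h1, ?_⟩
      rw [h5, triangle_of_le (by linarith) (by linarith)]
      refine le_trans ?_ (neg_le_abs _)
      linarith [h z h2]
  choose! c hc0 hc1 hcE using hper
  have hdisj : (J : Set ℕ).PairwiseDisjoint
      fun j => Set.Ioo ((j + c j) / M) ((j + c j + 1 / 8) / M) := by
    intro i hi j hj hij
    refine Set.disjoint_left.2 fun z hz hz' => ?_
    simp only [Set.mem_Ioo, div_lt_iff₀ hM0, lt_div_iff₀ hM0] at hz hz'
    have i0 := hc0 i hi
    have i1 := hc1 i hi
    have j0 := hc0 j hj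
    have j1 := hc1 j hj
    rcases lt_or_gt_of_ne hij with h | h
    · have : (i : ℝ) + 1 ≤ j := by exact_mod_cast h
      linarith
    · have : (j : ℝ) + 1 ≤ i := by exact_mod_cast h
      linarith
  calc ENNReal.ofReal (1 / 16) ≤ ENNReal.ofReal (J.card * (1 / 8 / M)) := by
        apply ENNReal.ofReal_le_ofReal
        have : (2 : ℝ) ^ m ≤ J.card := by exact_mod_cast hcard
        calc (1 / 16 : ℝ) = 2 ^ m * (1 / 8 / M) := by rw [hM, pow_succ]; field_simp; norm_num
          _ ≤ _ := by gcongr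
    _ = ∑ j ∈ J, volume (Set.Ioo ((j + c j) / M) ((j + c j + 1 / 8) / M)) := by
        rw [ENNReal.ofReal_mul (by positivity), ENNReal.ofReal_natCast, ← nsmul_eq_mul,
          ← Finset.sum_const]
        refine Finset.sum_congr rfl fun j _ => ?_
        rw [Real.volume_Ioo]
        congr 1
        ring
    _ = volume (⋃ j ∈ J, Set.Ioo ((j + c j) / M) ((j + c j + 1 / 8) / M)) :=
        (measure_biUnion_finset hdisj fun _ _ => measurableSet_Ioo).symm
    _ ≤ volume E := measure_mono (Set.iUnion₂_subset hcE)

/-- Fubini's theorem and Markov's inequality lift the one-dimensional estimate to the cube. The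
boundedness of `g` makes the integral a genuine one. -/
theorem le_integral_abs_triangle_iterate_sub {n m : ℕ} {g : (Fin (n + 1) → ℝ) → ℝ}
    (hg : Measurable g) (hb : ∃ C, ∀ x ∈ Set.Icc (0 : Fin (n + 1) → ℝ) 1, |g x| ≤ C)
    (hS : ∀ y : Fin n → ℝ, ∃ S : Finset ℝ, S.card ≤ 2 ^ m ∧
      HoldsOff S (OneSided fun z => g (Fin.cons z y))) :
    1 / 64 ≤ ∫ x in Set.Icc (0 : Fin (n + 1) → ℝ) 1, |triangle^[m + 2] (x 0) - g x| := by
  have hfc : Continuous fun x : Fin (n + 1) → ℝ => triangle^[m + 2] (x 0) :=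
    (continuous_triangle.iterate _).comp (continuous_apply 0)
  have hmeas : Measurable fun x : Fin (n + 1) → ℝ => |triangle^[m + 2] (x 0) - g x| :=
    (hfc.measurable.sub hg).abs
  have hint : IntegrableOn (fun x : Fin (n + 1) → ℝ => |triangle^[m + 2] (x 0) - g x|)
      (Set.Icc 0 1) := by
    obtain ⟨C, hC⟩ := hb
    obtain ⟨C', hC'⟩ := (isCompact_Icc
      (a := (0 : Fin (n + 1) → ℝ)) (b := 1)).exists_bound_of_continuousOn hfc.continuousOn
    refine IntegrableOn.of_bound (isCompact_Icc.measure_lt_top) hmeas.aestronglyMeasurable (C' + C)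
      ((ae_restrict_iff' measurableSet_Icc).2 (ae_of_all _ fun x hx => ?_))
    rw [Real.norm_eq_abs, abs_abs]
    exact (abs_sub _ _).trans (add_le_add (hC' x hx) (hC x hx))
  set E := {x : Fin (n + 1) → ℝ | x ∈ Set.Icc (0 : Fin (n + 1) → ℝ) 1 ∧
    1 / 4 ≤ |triangle^[m + 2] (x 0) - g x|} with hE
  have hEm : MeasurableSet E := measurableSet_Icc.inter (measurableSet_le measurable_const hmeas)
  -- Fubini: each slice of `E` in the direction of the first coordinate has measure `≥ 1 / 16`
  have hvol : ENNReal.ofReal (1 / 16) ≤ volume E := by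
    have hp := (volume_preserving_piFinSuccAbove (fun _ : Fin (n + 1) => ℝ) 0).symm
    rw [← hp.measure_preimage hEm.nullMeasurableSet,
      Measure.volume_eq_prod, Measure.prod_apply_symm (hp.measurable hEm)]
    calc ENNReal.ofReal (1 / 16)
        = ∫⁻ _ in Set.Icc (0 : Fin n → ℝ) 1, ENNReal.ofReal (1 / 16) := by
          simp [Real.volume_Icc_pi]
      _ ≤ ∫⁻ y in Set.Icc (0 : Fin n → ℝ) 1, volume ((fun z => (z, y)) ⁻¹'
          ((MeasurableEquiv.piFinSuccAbove (fun _ : Fin (n + 1) => ℝ) 0).symm ⁻¹' E)) := by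
          refine setLIntegral_mono' measurableSet_Icc fun y hy => ?_
          obtain ⟨S, hS, hQ⟩ := hS y
          refine (volume_far_triangle_iterate hS hQ).trans (measure_mono ?_)
          rintro z ⟨hz, hz'⟩
          have : (MeasurableEquiv.piFinSuccAbove (fun _ : Fin (n + 1) => ℝ) 0).symm (z, y)
            = Fin.cons z y := by
            simp [MeasurableEquiv.piFinSuccAbove, Fin.insertNthEquiv]
          simp only [Set.mem_preimage, this, hE, Set.mem_ofPred_eq, Fin.cons_zero]
          refine ⟨⟨fun i => ?_, fun i => ?_⟩, hz'⟩
          · refine Fin.cases ?_ (fun i => ?_) i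
            exacts [hz.1, by simpa using hy.1 i]
          · refine Fin.cases ?_ (fun i => ?_) i
            exacts [hz.2, by simpa using hy.2 i]
      _ ≤ _ := setLIntegral_le_lintegral _ _
  have hmark := mul_meas_ge_le_integral_of_nonneg
    (μ := volume.restrict (Set.Icc (0 : Fin (n + 1) → ℝ) 1))
    (f := fun x => |triangle^[m + 2] (x 0) - g x|) (ae_of_all _ fun _ => abs_nonneg _) hint (1 / 4)
  refine le_trans ?_ hmark
  have hle : 1 / 16 ≤ (volume.restrict (Set.Icc (0 : Fin (n + 1) → ℝ) 1)).real
      {x | 1 / 4 ≤ |triangle^[m + 2] (x 0) - g x|} := by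
    have hr : (volume.restrict (Set.Icc (0 : Fin (n + 1) → ℝ) 1))
      {x | 1 / 4 ≤ |triangle^[m + 2] (x 0) - g x|} = volume E := by
      rw [Measure.restrict_apply (measurableSet_le measurable_const hmeas), Set.inter_comm]
      rfl
    rw [Measure.real, hr]
    refine (ENNReal.ofReal_le_iff_le_toReal ?_).1 hvol
    exact ((measure_mono fun x hx => hx.1).trans_lt
      (isCompact_Icc (a := (0 : Fin (n + 1) → ℝ)) (b := 1)).measure_lt_top).ne
  linarith

/-! ### The deep ReLU network -/

/-- The index of the parameter on the edge from `s` to node `v` of `triangleNetwork`. Parameter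
`4 + i` is the weight of the `i`-th input; parameter `4`, whose value is `1`, also serves as the
weight of the edges between consecutive triangle maps. -/
def triangleWeight {n d : ℕ} (hd : 1 ≤ d) (v : Fin (3 * n)) : Fin d ⊕ Fin (3 * n) → Fin (4 + d)
  | Sum.inl i => Fin.natAdd 4 i
  | Sum.inr u => if v.val % 3 = 2 then Fin.castAdd d (if u.val % 3 = 0 then 2 else 3)
      else Fin.natAdd 4 ⟨0, hd⟩

/-- The index of the bias parameter of node `v` of `triangleNetwork`. -/
def triangleBias {n : ℕ} (d : ℕ) (v : Fin (3 * n)) : Fin (4 + d) :=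
  Fin.castAdd d (if v.val % 3 = 1 then 1 else 0)

/-- The values of the parameters of `triangleNetwork`. -/
noncomputable def triangleParams {d : ℕ} (hd : 1 ≤ d) : Fin (4 + d) → ℝ :=
  Fin.append ![0, -1 / 2, 2, -4] fun i => if i = ⟨0, hd⟩ then 1 else 0

/-- The tails of the edges that enter node `v` of `triangleNetwork`. -/
def triangleParents (n d : ℕ) (v : Fin (3 * n)) : Finset (Fin d ⊕ Fin (3 * n)) :=
  if v.val % 3 = 2 then {Sum.inr ⟨v - 2, by omega⟩, Sum.inr ⟨v - 1, by omega⟩}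
  else if v.val < 3 then Finset.univ.map Function.Embedding.inl
  else {Sum.inr ⟨3 * (v.val / 3) - 1, by omega⟩}

theorem inl_mem_triangleParents {n d : ℕ} {v : Fin (3 * n)} {i : Fin d} :
    Sum.inl i ∈ triangleParents n d v ↔ v.val < 2 := by
  unfold triangleParents
  split_ifs <;> simp <;> omega

theorem inr_mem_triangleParents {n d : ℕ} {u v : Fin (3 * n)} :
    Sum.inr u ∈ triangleParents n d v ↔
      v.val % 3 = 2 ∧ (u.val + 2 = v ∨ u.val + 1 = v) ∨
        v.val % 3 ≠ 2 ∧ u.val + 1 = 3 * (v.val / 3) := by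
  unfold triangleParents
  split_ifs <;> simp [Fin.ext_iff] <;> omega

/-- The network for `triangle^[n]`. The `i`-th triangle map `z ↦ σ(2 σ(z) - 4 σ(z - 1/2))` uses the
nodes `3 i` for `σ(z)`, `3 i + 1` for `σ(z - 1/2)` (both in layer `2 i + 1`), and `3 i + 2` for the
outer `σ` (in layer `2 i + 2`). -/
noncomputable def triangleNetwork {n d : ℕ} (hn : 1 ≤ n) (hd : 1 ≤ d) : Network d (4 + d) where
  numNodes := 3 * n
  parents := triangleParents n d
  input_only_at_roots v i hi u hu := by
    rw [inl_mem_triangleParents] at hi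
    rw [inr_mem_triangleParents] at hu
    omega
  layer v := 2 * (v.val / 3) + 1 + v.val % 3 / 2
  layer_eq v := by
    rw [Nat.add_right_comm, Nat.add_right_cancel_iff]
    apply le_antisymm
    · rcases lt_or_ge v.val 2 with hv | hv
      · omega
      · let u : Fin (3 * n) :=
          ⟨if v.val % 3 = 2 then v - 2 else 3 * (v.val / 3) - 1, by split_ifs <;> omega⟩
        have hu : u.val = if v.val % 3 = 2 then v.val - 2 else 3 * (v.val / 3) - 1 := rfl
        refine le_trans ?_ (Finset.le_sup (b := Sum.inr u) (inr_mem_triangleParents.2 ?_))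
        · simp only [Sum.elim_inr]
          split_ifs at hu <;> omega
        · split_ifs at hu <;> omega
    · refine Finset.sup_le ?_
      rintro (i | u) hu
      · simp
      · rw [inr_mem_triangleParents] at hu
        simp only [Sum.elim_inr]
        omega
  out := ⟨3 * n - 1, by omega⟩
  out_iff u := by
    simp only [inr_mem_triangleParents, Fin.ext_iff]
    constructor
    · intro hu v
      omega
    · intro h
      by_contra hu
      have h2 := u.isLt
      by_cases h3 : u.val % 3 = 2
      · have := h ⟨u + 1, by omega⟩
        simp only at this
        omega
      · have := h ⟨3 * (u.val / 3) + 2, by omega⟩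
        simp only at this
        omega
  gate v w z := max 0 (∑ s, w (triangleWeight hd v s.1) * z s + w (triangleBias d v))

section

variable {n d : ℕ} (hn : 1 ≤ n) (hd : 1 ≤ d)

theorem triangleNetwork_isReLU : (triangleNetwork hn hd).IsReLU := by
  refine ⟨fun v s => triangleWeight hd v s.1, triangleBias d, fun _ _ _ => rfl, fun j => ?_⟩
  let v₀ : Fin (3 * n) := ⟨0, by omega⟩
  let v₁ : Fin (3 * n) := ⟨1, by omega⟩
  let v₂ : Fin (3 * n) := ⟨2, by omega⟩
  refine Fin.addCases (fun j => ?_) (fun i => ?_) j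
  · fin_cases j
    · exact Or.inr ⟨v₀, by simp [triangleBias, v₀]⟩
    · exact Or.inr ⟨v₁, by simp [triangleBias, v₁]⟩
    · refine Or.inl ⟨v₂, ⟨Sum.inr v₀, inr_mem_triangleParents.2 ?_⟩, ?_⟩
      · simp [v₀, v₂]
      · simp [triangleWeight, v₀, v₂]
    · refine Or.inl ⟨v₂, ⟨Sum.inr v₁, inr_mem_triangleParents.2 ?_⟩, ?_⟩
      · simp [v₁, v₂]
      · simp [triangleWeight, v₁, v₂]
  · exact Or.inl ⟨v₀, ⟨Sum.inl i, inl_mem_triangleParents.2 (by simp [v₀])⟩, rfl⟩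

theorem triangleNetwork_isLayered : (triangleNetwork hn hd).IsLayered := by
  intro u v h
  have h := inr_mem_triangleParents.1 h
  change 2 * (v.val / 3) + 1 + v.val % 3 / 2 = 2 * (u.val / 3) + 1 + u.val % 3 / 2 + 1
  omega

theorem triangleNetwork_numLayers : (triangleNetwork hn hd).numLayers = 2 * n := by
  apply le_antisymm
  · refine Finset.sup_le fun v _ => ?_
    have hv : v.val < 3 * n := v.isLt
    change 2 * (v.val / 3) + 1 + v.val % 3 / 2 ≤ 2 * n
    omega
  · refine le_trans ?_ (Finset.le_sup (f := (triangleNetwork hn hd).layer)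
      (Finset.mem_univ (triangleNetwork hn hd).out))
    change 2 * n ≤ 2 * ((3 * n - 1) / 3) + 1 + (3 * n - 1) % 3 / 2
    omega

/-- The values of the nodes of `triangleNetwork`. -/
noncomputable def triangleValue (x : Fin d → ℝ) : Fin (3 * n) → ℝ :=
  (triangleNetwork hn hd).value (triangleParams hd) x

theorem triangleValue_eq (x : Fin d → ℝ) (v : Fin (3 * n)) :
    triangleValue hn hd x v =
      max 0 (∑ s ∈ triangleParents n d v, triangleParams hd (triangleWeight hd v s) *
          Sum.elim x (triangleValue hn hd x) s + triangleParams hd (triangleBias d v)) := by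
  rw [← Finset.sum_coe_sort]
  exact Network.value_eq _ _ _ _

theorem triangleParams_bias {v : Fin (3 * n)} (hv : v.val % 3 ≠ 2) :
    triangleParams hd (triangleBias d v) = -((v.val % 3 : ℕ) : ℝ) / 2 := by
  rw [triangleParams, triangleBias, Fin.append_left]
  rcases (show v.val % 3 = 0 ∨ v.val % 3 = 1 by omega) with h | h <;> simp [h]

/-- The third node of a triangle map combines the first two. -/
theorem triangleValue_of_mod_eq_two {x : Fin d → ℝ} {v : Fin (3 * n)} {y : ℝ}
    (hv : v.val % 3 = 2) (h : ∀ u : Fin (3 * n), u.val / 3 = v.val / 3 → u.val % 3 ≠ 2 →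
      triangleValue hn hd x u = max 0 (y + -((u.val % 3 : ℕ) : ℝ) / 2)) :
    triangleValue hn hd x v = triangle y := by
  have h2 : (v.val - 2) % 3 = 0 := by omega
  have h1 : (v.val - 1) % 3 = 1 := by omega
  rw [triangleValue_eq, triangleParents, if_pos hv, Finset.sum_pair (by simp; omega),
    Sum.elim_inr, Sum.elim_inr, h _ (by simp only; omega) (by simp only; omega),
    h _ (by simp only; omega) (by simp only; omega)]
  simp only [triangleWeight, hv, h1, h2, triangleBias, triangleParams, Fin.append_left, triangle]
  norm_num
  congr 1
  change 2 * max 0 y + -4 * max 0 (y + -(1 / 2)) = _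
  ring_nf

theorem triangleValue_last (x : Fin d → ℝ) (i : ℕ) : ∀ v : Fin (3 * n), v.val = 3 * i + 2 →
    triangleValue hn hd x v = triangle^[i + 1] (x ⟨0, hd⟩) := by
  induction i with
  | zero =>
    intro v hv
    refine triangleValue_of_mod_eq_two hn hd (by omega) fun u hu hu' => ?_
    rw [triangleValue_eq, triangleParams_bias hd hu', triangleParents, if_neg hu',
      if_pos (by omega), Finset.sum_map]
    congr 2
    simp only [Function.Embedding.inl_apply, Sum.elim_inl]
    simp [triangleWeight, triangleParams]
  | succ i ih =>
    intro v hv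
    rw [Function.iterate_succ_apply']
    refine triangleValue_of_mod_eq_two hn hd (by omega) fun u hu hu' => ?_
    rw [triangleValue_eq, triangleParams_bias hd hu', triangleParents, if_neg hu',
      if_neg (by omega), Finset.sum_singleton, Sum.elim_inr, ih _ (by simp only; omega),
      triangleWeight, if_neg hu', triangleParams, Fin.append_right, if_pos rfl, one_mul]

theorem triangleNetwork_output (x : Fin d → ℝ) :
    (triangleNetwork hn hd).output (triangleParams hd) x = triangle^[n] (x ⟨0, hd⟩) := by
  obtain ⟨i, rfl⟩ : ∃ i, n = i + 1 := ⟨n - 1, by omega⟩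
  exact triangleValue_last hn hd x i _ (show 3 * (i + 1) - 1 = 3 * i + 2 by omega)

end

end DepthSeparation

theorem theorem1 (k d : ℕ) (hk : 1 ≤ k) (hd : 1 ≤ d) :
    ∃ f : (Fin d → ℝ) → ℝ,
      (∀ x, f x = DepthSeparation.triangle^[k ^ 3 + 4] (x ⟨0, hd⟩)) ∧
      (∃ (N : DepthSeparation.Network d (4 + d)) (w : Fin (4 + d) → ℝ),
        N.IsReLU ∧ N.IsLayered ∧ N.numLayers = 2 * k ^ 3 + 8 ∧ N.numNodes = 3 * k ^ 3 + 12 ∧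
        f = N.output w) ∧
      ∀ g ∈ DepthSeparation.shallowClass d k,
        (1 / 64 : ℝ) ≤ ∫ x in Set.Icc (0 : Fin d → ℝ) 1, |f x - g x| := by
  open DepthSeparation in
  have hn : 1 ≤ k ^ 3 + 4 := by omega
  refine ⟨fun x => triangle^[k ^ 3 + 4] (x ⟨0, hd⟩), fun _ => rfl, ?_, fun g hg => ?_⟩
  · refine ⟨triangleNetwork hn hd, triangleParams hd, triangleNetwork_isReLU hn hd,
      triangleNetwork_isLayered hn hd, ?_, ?_, ?_⟩
    · rw [triangleNetwork_numLayers, mul_add]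
    · change 3 * (k ^ 3 + 4) = _
      rw [mul_add]
    · exact funext fun x => (triangleNetwork_output hn hd x).symm
  · obtain ⟨n, rfl⟩ : ∃ n, d = n + 1 := ⟨d - 1, by omega⟩
    obtain ⟨hm, hb, hS⟩ := shallowClass_spec hk hg
    refine le_integral_abs_triangle_iterate_sub (m := k ^ 3 + 2) hm hb fun y => hS _ fun j => ?_
    refine Fin.cases ?_ (fun i => ?_) j
    · exact ⟨Polynomial.X, Polynomial.natDegree_X_le, fun z => by simp⟩
    · exact ⟨Polynomial.C (y i), by simp, fun z => by simp⟩
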